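/- There is an absolute constant $C>0$ such that, for every positive integer $N$, there is a red/blue coloring of the edges of the complete $3$-uniform hypergraph $K_N^{(3)}$ on $N$ vertices with the following two properties. (1) Every red tightly connected subgraph $H$ of $K_N^{(3)}$ is tripartite. Here $H$ is red if all of its edges are red; $H$ is tightly connected if for any two edges $e,f$ of $H$ there is a sequence of edges $e=e_0,e_1,\dots,e_t=f$ of $H$ such that $e_{i-1}$ and $e_i$ share two vertices for all $i=1,\dots,t$; and $H$ is tripartite if its vertices can be partitioned into three (possibly empty) parts such that every edge has exactly one vertex in each part. (2) If $N\ge 2$, then every blue clique, that is, every set of vertices all of whose triples are blue, has at most $C(\log N)^{3/2}$ vertices. -/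

import Mathlib

/-- The two colors. -/
inductive RBColor where
  | red
  | blue

/-- A `3`-graph: a vertex set inside `V`, together with a set of edges, each of which is a set of
exactly three of the vertices. -/
structure ThreeGraph (V : Type*) where
  verts : Set V
  edges : Set (Finset V)
  card_eq_three : ∀ e ∈ edges, e.card = 3
  edge_subset_verts : ∀ e ∈ edges, ∀ v ∈ e, v ∈ verts

namespace ThreeGraph

/-- The complete `3`-graph on all of `V`; on `Fin N` it is `K_N^{(3)}`. -/
def complete (V : Type*) : ThreeGraph V where
  verts := Set.univ
  edges := {e | e.card = 3}
  card_eq_three := fun _ he => he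
  edge_subset_verts := fun _ _ v _ => Set.mem_univ v

/-- `H` is a subgraph of `G` (not necessarily induced, not necessarily spanning). -/
def IsSubgraph {V : Type*} (H G : ThreeGraph V) : Prop :=
  H.verts ⊆ G.verts ∧ H.edges ⊆ G.edges

/-- Any two edges `e`, `f` are joined by a finite sequence of edges of `H`, starting with `e` and
ending with `f`, in which consecutive edges share two vertices. -/
def TightlyConnected {V : Type*} [DecidableEq V] (H : ThreeGraph V) : Prop :=
  ∀ e f : H.edges,
    Relation.ReflTransGen (fun a b : H.edges => ((a : Finset V) ∩ (b : Finset V)).card = 2) e f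

/-- The vertices can be split into three (possibly empty) parts such that every edge has exactly
one vertex in each part. -/
def Tripartite {V : Type*} (H : ThreeGraph V) : Prop :=
  ∃ part : H.verts → Fin 3, ∀ e ∈ H.edges, ∀ i : Fin 3,
    ∃! v : H.verts, (v : V) ∈ e ∧ part v = i

/-- A red/blue coloring of the edges of `G`. -/
abbrev EdgeColoring {V : Type*} (G : ThreeGraph V) : Type _ :=
  G.edges → RBColor

/-- All edges of the subgraph `H` of `G` are red. -/
def IsRedSubgraph {V : Type*} {G : ThreeGraph V} (χ : G.EdgeColoring) (H : ThreeGraph V) : Prop :=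
  H.IsSubgraph G ∧ ∀ e : G.edges, (e : Finset V) ∈ H.edges → χ e = RBColor.red

/-- `S` spans a blue clique: every triple of vertices of `S` is an edge of `G` colored blue. Any
set of at most two vertices is a blue clique. -/
def IsBlueClique {V : Type*} {G : ThreeGraph V} (χ : G.EdgeColoring) (S : Finset V) : Prop :=
  (∀ v ∈ S, v ∈ G.verts) ∧
    ∀ e : Finset V, e ⊆ S → e.card = 3 → ∃ he : e ∈ G.edges, χ ⟨e, he⟩ = RBColor.blue

end ThreeGraph

namespace TightRamsey

open Finset
open scoped BigOperators


/-! Colour the pairs of vertices with `t` colours and attach to every colour a labelling of the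
vertices by three labels. A triple is red when its pairs share one colour `i` and the labelling of
`i` separates its vertices. Red triples with a common pair have the same colour, so a tightly
connected red subgraph has a single colour, whose labelling is a tripartition (`tripartite_of_red`).

Labellings and pair colouring are chosen at random. Since `t ≥ 100 log N`, some labellings make
every triple rainbow for at least `t / 10` colours (`exists_labels`). Three disjoint `m`-sets then
span about `m ^ 3 / (10 * t ^ 2)` red triples on average, which is of order `m * t` once `m` has
order `t ^ (3 / 2)`. The core is that none occurs with probability at most `5 * exp (-(m * t / 10))`
(`expect_no_triangle_le`), which beats the `N ^ (3 * m)` choices of the sets. So blue cliques have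
fewer than `3 * m` vertices, and `m` has order `(log N) ^ (3 / 2)`.

For the core, expose the colours `f` on `A × B`, then `h` on `A × D`, then `g` on `B × D`. Given a
typical `f`, each value of `h` forbids some values of `g`. The forbidden values rarely overlap much,
so their number has a small exponential moment (`expect_exp_cover_le`), and `g` rarely avoids them
all (`expect_avoid_le`). -/

/-! ### Averages over uniformly random functions -/

lemma expect_pi_prod {X K : Type*} [Fintype X] [DecidableEq X] [Fintype K] (F : X → K → ℝ) :
    𝔼 h : X → K, ∏ x, F x (h x) = ∏ x, 𝔼 k, F x k := by
  simp only [Fintype.expect_eq_sum_div_card, Finset.prod_div_distrib, Finset.prod_univ_sum,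
    Fintype.piFinset_univ, Fintype.card_fun, Finset.prod_const, Finset.card_univ, Nat.cast_pow]

lemma expect_sum_arrow {I J K : Type*} [Fintype I] [DecidableEq I] [Fintype J] [DecidableEq J]
    [Fintype K] (F : (I ⊕ J → K) → ℝ) :
    𝔼 x, F x = 𝔼 f : I → K, 𝔼 g : J → K, F (Sum.elim f g) := by
  rw [← Finset.expect_product', Finset.univ_product_univ]
  refine Fintype.expect_equiv (Equiv.sumArrowEquivProdArrow I J K) _ _ fun x => ?_
  congr 1
  ext i
  cases i <;> rfl

/-- The values outside the range of `φ` are independent of those inside and average out. -/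
lemma expect_comp_injective {I J K : Type*} [Fintype I] [DecidableEq I] [Fintype J]
    [DecidableEq J] [Fintype K] [Nonempty K] {φ : I → J} (hφ : Function.Injective φ)
    (F : (I → K) → ℝ) : 𝔼 c : J → K, F (c ∘ φ) = 𝔼 x, F x := by
  classical
  let e : I ⊕ {j // j ∉ Set.range φ} ≃ J :=
    ((Equiv.ofInjective φ hφ).sumCongr (Equiv.refl _)).trans (Equiv.sumCompl (· ∈ Set.range φ))
  have he : ∀ i, e (Sum.inl i) = φ i := fun i => rfl
  rw [← Fintype.expect_equiv (Equiv.arrowCongr e (Equiv.refl K))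
    (fun x => F (x ∘ Sum.inl)) (fun c : J → K => F (c ∘ φ)), expect_sum_arrow]
  · simp
  · intro x
    congr 1
    ext i
    simp [Equiv.arrowCongr, ← he]

lemma exp_neg_le_one_sub_half {x : ℝ} (h0 : 0 ≤ x) (h1 : x ≤ 1) :
    Real.exp (-x) ≤ 1 - x / 2 := by
  have h := Real.abs_exp_sub_one_sub_id_le (x := -x) (by rw [abs_neg, abs_of_nonneg h0]; exact h1)
  have h2 := (abs_le.1 h).2
  -- The bound `exp (-x) ≤ 1 - x + x ^ 2` suffices only up to `1 / 2`; beyond it, the quadratic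
  -- lower bound for `exp x` is inverted.
  by_cases hx : x ≤ 1 / 2
  · nlinarith
  · have h3 : Real.exp (-x) = (Real.exp x)⁻¹ := Real.exp_neg x
    have h4 := Real.quadratic_le_exp_of_nonneg h0
    rw [h3, inv_le_comm₀ (Real.exp_pos _) (by linarith)]
    refine le_trans ?_ h4
    rw [inv_le_iff_one_le_mul₀ (by linarith)]
    nlinarith [mul_nonneg h0 h0, mul_nonneg h0 (mul_nonneg h0 (sub_nonneg.2 h1)),
      mul_nonneg h0 (sub_nonneg.2 h1)]

/-- A random variable with values in `[0, 1]`: bound for its Laplace transform. -/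
lemma expect_exp_neg_le {K : Type*} [Fintype K] [Nonempty K] (X : K → ℝ) (h0 : ∀ k, 0 ≤ X k)
    (h1 : ∀ k, X k ≤ 1) : 𝔼 k, Real.exp (-X k) ≤ Real.exp (-(𝔼 k, X k) / 2) := by
  calc 𝔼 k, Real.exp (-X k) ≤ 𝔼 k, (1 - X k / 2) :=
        Finset.expect_le_expect fun k _ => exp_neg_le_one_sub_half (h0 k) (h1 k)
    _ = -(𝔼 k, X k) / 2 + 1 := by
        rw [Finset.expect_sub_distrib, Fintype.expect_const, ← Finset.expect_div]; ring
    _ ≤ _ := Real.add_one_le_exp _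

/-! ### Exponential moment of a random union -/

section

variable {Z K : Type*} [DecidableEq Z] [Fintype K] [Nonempty K]

/-- Exponential moment of the size of a union of randomly chosen sets, corrected by the overlap of
this union with all the sets available. -/
lemma expect_exp_cover_fin (n : ℕ) (N : Fin n → K → Finset Z) {τ : ℝ} (hτ : 0 < τ)
    (hN : ∀ x k, (#(N x k) : ℝ) ≤ τ) (J₀ : Finset Z) :
    𝔼 h : Fin n → K, Real.exp (-(#(J₀ ∪ univ.biUnion fun x => N x (h x)) : ℝ) / τ
        - (∑ x, 𝔼 k, (#(N x k ∩ (J₀ ∪ univ.biUnion fun x => N x (h x))) : ℝ)) / (2 * τ))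
      ≤ Real.exp (-(#J₀ : ℝ) / τ - (∑ x, 𝔼 k, (#(N x k) : ℝ)) / (2 * τ)) := by
  -- `J₀` is what has been covered so far; each step exposes one more random set and adds it to
  -- `J₀`.
  induction n generalizing J₀ with
  | zero => simp
  | succ n ih =>
    rw [← Fintype.expect_equiv (Fin.consEquiv fun _ => K) (fun p : K × (Fin n → K) =>
      Real.exp (-(#(J₀ ∪ univ.biUnion fun x => N x (Fin.cons (α := fun _ => K) p.1 p.2 x)) : ℝ) / τ
        - (∑ x, 𝔼 k, (#(N x k ∩ (J₀ ∪ univ.biUnion fun x =>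
            N x (Fin.cons (α := fun _ => K) p.1 p.2 x))) : ℝ)) / (2 * τ))) _ (fun _ => rfl),
      ← Finset.univ_product_univ, Finset.expect_product]
    have hU : ∀ (k : K) (h : Fin n → K), J₀ ∪ univ.biUnion (fun x =>
        N x (Fin.cons (α := fun _ => K) k h x)) =
        (J₀ ∪ N 0 k) ∪ univ.biUnion (fun x => N x.succ (h x)) := by
      intro k h
      ext z
      simp only [mem_union, mem_biUnion, mem_univ, true_and, Fin.exists_fin_succ, Fin.cons_zero,
        Fin.cons_succ, or_assoc]
    simp only [hU, Fin.sum_univ_succ]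
    set κ : ℝ := 𝔼 k, (#(N 0 k ∩ J₀) : ℝ) with hκ
    set e₀ : ℝ := 𝔼 k, (#(N 0 k) : ℝ) with he₀
    set e : ℝ := ∑ x : Fin n, 𝔼 k, (#(N x.succ k) : ℝ) with he
    have hgain : ∀ k, (#(J₀ ∪ N 0 k) : ℝ) = #J₀ + #(N 0 k \ J₀) := by
      intro k
      rw [← Finset.union_sdiff_self_eq_union, Finset.card_union_of_disjoint disjoint_sdiff]
      push_cast; rfl
    have hsplit : 𝔼 k, (#(N 0 k \ J₀) : ℝ) = e₀ - κ := by
      rw [he₀, hκ, ← Finset.expect_sub_distrib]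
      refine Finset.expect_congr rfl fun k _ => ?_
      rw [← Finset.card_sdiff_add_card_inter (N 0 k) J₀]
      push_cast; ring
    calc _ ≤ 𝔼 k, Real.exp (-κ / (2 * τ)) *
            Real.exp (-(#(J₀ ∪ N 0 k) : ℝ) / τ - e / (2 * τ)) := by
          refine Finset.expect_le_expect fun k _ => ?_
          refine le_trans ?_ (mul_le_mul_of_nonneg_left
            (ih (fun x => N x.succ) (fun x => hN _) (J₀ ∪ N 0 k)) (Real.exp_pos _).le)
          rw [Finset.mul_expect]
          refine Finset.expect_le_expect fun h _ => ?_
          rw [← Real.exp_add]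
          refine Real.exp_le_exp.2 ?_
          -- The final union contains `J₀`, so the overlap `κ` lost at this step is paid for by the
          -- correction term.
          have : κ ≤ 𝔼 k', (#(N 0 k' ∩ (J₀ ∪ N 0 k ∪ univ.biUnion fun x => N x.succ (h x))) : ℝ) := by
            refine Finset.expect_le_expect fun k' _ => ?_
            refine Nat.cast_le.2 (Finset.card_le_card (Finset.inter_subset_inter_left ?_))
            rw [Finset.union_assoc]; exact Finset.subset_union_left
          have h2 := div_le_div_of_nonneg_right this (by positivity : 0 ≤ 2 * τ)
          rw [add_div, neg_div (2 * τ) κ]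
          linarith
      _ = Real.exp (-κ / (2 * τ) - (#J₀ : ℝ) / τ - e / (2 * τ)) *
            𝔼 k, Real.exp (-((#(N 0 k \ J₀) : ℝ) / τ)) := by
          rw [Finset.mul_expect]
          refine Finset.expect_congr rfl fun k _ => ?_
          rw [← Real.exp_add, ← Real.exp_add, hgain]
          congr 1; ring
      _ ≤ Real.exp (-κ / (2 * τ) - (#J₀ : ℝ) / τ - e / (2 * τ)) *
            Real.exp (-(𝔼 k, (#(N 0 k \ J₀) : ℝ) / τ) / 2) := by
          refine mul_le_mul_of_nonneg_left (expect_exp_neg_le _ (fun k => by positivity)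
            fun k => ?_) (Real.exp_pos _).le
          refine div_le_one_of_le₀ (le_trans ?_ (hN 0 k)) hτ.le
          exact Nat.cast_le.2 (Finset.card_le_card sdiff_subset)
      _ = _ := by
          rw [← Finset.expect_div, hsplit, ← Real.exp_add]
          congr 1
          field_simp
          ring

lemma expect_exp_cover {X : Type*} [Fintype X] [DecidableEq X] (N : X → K → Finset Z) {τ : ℝ}
    (hτ : 0 < τ) (hN : ∀ x k, (#(N x k) : ℝ) ≤ τ) :
    𝔼 h : X → K, Real.exp (-(#(univ.biUnion fun x => N x (h x)) : ℝ) / τ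
        - (∑ x, 𝔼 k, (#(N x k ∩ univ.biUnion fun x => N x (h x)) : ℝ)) / (2 * τ))
      ≤ Real.exp (-(∑ x, 𝔼 k, (#(N x k) : ℝ)) / (2 * τ)) := by
  have e := Fintype.equivFin X
  have h := expect_exp_cover_fin _ (fun x => N (e.symm x)) hτ (fun x => hN _) ∅
  simp only [Finset.empty_union, Finset.card_empty, Nat.cast_zero, neg_zero, zero_div,
    zero_sub] at h
  rw [Equiv.sum_comp e.symm (fun x => 𝔼 k, (#(N x k) : ℝ)), ← neg_div] at h
  refine le_trans (le_of_eq ?_) h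
  refine Fintype.expect_equiv (Equiv.arrowCongr e (Equiv.refl K)) _ _ fun h => ?_
  have hU : (univ.biUnion fun x => N (e.symm x) ((Equiv.arrowCongr e (Equiv.refl K)) h x)) =
      univ.biUnion fun x => N x (h x) := by
    ext z
    simp only [mem_biUnion, mem_univ, true_and]
    exact (Equiv.exists_congr_left e (p := fun x => z ∈ N x (h x))).symm
  simp only [hU]
  rw [Equiv.sum_comp e.symm (fun x => 𝔼 k, (#(N x k ∩ univ.biUnion fun x => N x (h x)) : ℝ))]

/-- Either the union exceeds `M`, giving the first term, or its overlap is at most `κ` and the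
corrected moment gives the second. -/
lemma expect_exp_cover_le {X : Type*} [Fintype X] [DecidableEq X] (N : X → K → Finset Z)
    {τ M κ : ℝ} (hτ : 0 < τ) (hN : ∀ x k, (#(N x k) : ℝ) ≤ τ)
    (hκ : ∀ J : Finset Z, (#J : ℝ) ≤ M → ∑ x, 𝔼 k, (#(N x k ∩ J) : ℝ) ≤ κ) :
    𝔼 h : X → K, Real.exp (-(#(univ.biUnion fun x => N x (h x)) : ℝ) / τ)
      ≤ Real.exp (-M / τ) + Real.exp ((κ - ∑ x, 𝔼 k, (#(N x k) : ℝ)) / (2 * τ)) := by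
  have h := mul_le_mul_of_nonneg_left (expect_exp_cover N hτ hN) (Real.exp_pos (κ / (2 * τ))).le
  rw [← Real.exp_add, Finset.mul_expect, ← add_div, ← sub_eq_add_neg] at h
  refine le_trans ?_ (add_le_add_right h _)
  rw [← Fintype.expect_const (ι := X → K) (Real.exp (-M / τ)), ← Finset.expect_add_distrib]
  refine Finset.expect_le_expect fun h _ => ?_
  rw [← Real.exp_add]
  by_cases hJ : (#(univ.biUnion fun x => N x (h x)) : ℝ) ≤ M
  · refine le_add_of_nonneg_of_le (Real.exp_pos _).le (Real.exp_le_exp.2 ?_)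
    have := div_le_div_of_nonneg_right (hκ _ hJ) (by positivity : 0 ≤ 2 * τ)
    linarith
  · refine le_add_of_le_of_nonneg (Real.exp_le_exp.2 ?_) (Real.exp_pos _).le
    exact div_le_div_of_nonneg_right (by linarith) hτ.le

end

/-! ### Probability estimates for random functions -/

section

open scoped Classical

/-- The indicator of a proposition, so that `𝔼 ω, ind (A ω)` is the probability of `A`. -/
noncomputable def ind (p : Prop) : ℝ := if p then 1 else 0

lemma ind_nonneg (p : Prop) : 0 ≤ ind p := by
  unfold ind; split_ifs <;> norm_num

lemma ind_le_of {p : Prop} {x : ℝ} (h0 : 0 ≤ x) (h : p → 1 ≤ x) : ind p ≤ x := by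
  unfold ind; split_ifs with hp
  exacts [h hp, h0]

lemma ind_le_one (p : Prop) : ind p ≤ 1 := ind_le_of zero_le_one fun _ => le_rfl

lemma ind_of {p : Prop} (h : p) : ind p = 1 := if_pos h

lemma ind_of_not {p : Prop} (h : ¬p) : ind p = 0 := if_neg h

lemma sum_ind {α : Type*} (s : Finset α) (p : α → Prop) [DecidablePred p] :
    ∑ a ∈ s, ind (p a) = #{a ∈ s | p a} := by
  rw [← Finset.sum_boole]
  exact Finset.sum_congr rfl fun a _ => by unfold ind; congr

lemma expect_ind {α : Type*} [Fintype α] (p : α → Prop)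
    [DecidablePred p] : 𝔼 a, ind (p a) = (#{a | p a} : ℝ) / Fintype.card α := by
  rw [Fintype.expect_eq_sum_div_card, sum_ind]

variable {K : Type*} [Fintype K] [Nonempty K]

/-- If `J` is a set of forbidden values, then a random function avoids all of them with
probability at most `exp (-#J / #K)`. -/
lemma expect_avoid_le {Y : Type*} [Fintype Y] [DecidableEq Y] (J : Finset (Y × K)) :
    𝔼 g : Y → K, ind (∀ y, (y, g y) ∉ J) ≤ Real.exp (-(#J : ℝ) / Fintype.card K) := by
  have hK : (0 : ℝ) < Fintype.card K := by exact_mod_cast Fintype.card_pos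
  have h1 : ∀ g : Y → K, ind (∀ y, (y, g y) ∉ J) = ∏ y, ind ((y, g y) ∉ J) := by
    intro g
    by_cases h : ∀ y, (y, g y) ∉ J
    · rw [ind_of h, Finset.prod_eq_one fun y _ => ind_of (h y)]
    · rw [ind_of_not h]
      push Not at h
      obtain ⟨y, hy⟩ := h
      exact (Finset.prod_eq_zero (mem_univ y) (ind_of_not (not_not.2 hy))).symm
  have hcard : (#J : ℝ) = ∑ y, (#{k | (y, k) ∈ J} : ℝ) := by
    simp only [← sum_ind]
    rw [← Fintype.sum_prod_type' (f := fun y k => ind ((y, k) ∈ J)),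
      sum_ind univ (fun z : Y × K => (z.1, z.2) ∈ J)]
    simp
  simp only [h1]
  rw [expect_pi_prod (fun y k => ind ((y, k) ∉ J)), hcard, ← Finset.sum_neg_distrib,
    Finset.sum_div, Real.exp_sum]
  refine Finset.prod_le_prod (fun y _ => Finset.expect_nonneg fun k _ => ind_nonneg _)
    fun y _ => ?_
  have h2 : 𝔼 k, ind ((y, k) ∉ J) = -(#{k | (y, k) ∈ J} : ℝ) / Fintype.card K + 1 := by
    rw [expect_ind, div_add_one hK.ne']
    congr 1
    have := Finset.card_filter_add_card_filter_not (s := (univ : Finset K)) (fun k => (y, k) ∈ J)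
    rw [Finset.card_univ] at this
    rw [← this]; push_cast; ring
  rw [h2]
  exact Real.add_one_le_exp _

/-- Two random functions `h`, `g` and a labelled bipartite graph `E`: bound for the probability
that no edge has the same label as both its ends. -/
lemma expect_no_match_le {X Y : Type*} [Fintype X] [DecidableEq X] [Fintype Y] [DecidableEq Y]
    (E : X → Y → Prop)
    (l : X → Y → K) {M κ : ℝ}
    (hdeg : ∀ x k, (#{y | E x y ∧ l x y = k} : ℝ) ≤ Fintype.card K)
    (hκ : ∀ J : Finset (Y × K), (#J : ℝ) ≤ M →
      ∑ x, (#{y | E x y ∧ (y, l x y) ∈ J} : ℝ) ≤ κ) :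
    𝔼 h : X → K, 𝔼 g : Y → K, ind (∀ x y, E x y → ¬(h x = l x y ∧ g y = l x y)) ≤
      Real.exp (-M / Fintype.card K) +
        Real.exp ((κ - ∑ x, (#{y | E x y} : ℝ)) / (2 * (Fintype.card K : ℝ) ^ 2)) := by
  have hK : (0 : ℝ) < Fintype.card K := by exact_mod_cast Fintype.card_pos
  set t : ℝ := (Fintype.card K : ℝ) with ht
  -- Once `h x = k`, the values `g y = k` are forbidden for the neighbours `y` joined to `x` by
  -- label `k`.
  let N : X → K → Finset (Y × K) := fun x k =>
    ({y | E x y ∧ l x y = k} : Finset Y).map ⟨fun y => (y, k), fun a b h => (Prod.ext_iff.1 h).1⟩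
  have hmem : ∀ x k z, z ∈ N x k ↔ E x z.1 ∧ l x z.1 = k ∧ z.2 = k := by
    intro x k z
    simp only [N, mem_map, mem_filter, mem_univ, true_and]
    constructor
    · rintro ⟨y, ⟨h1, h2⟩, rfl⟩; exact ⟨h1, h2, rfl⟩
    · rintro ⟨h1, h2, h3⟩; exact ⟨z.1, ⟨h1, h2⟩, Prod.ext rfl h3.symm⟩
  have hcap : ∀ x J, 𝔼 k, (#(N x k ∩ J) : ℝ) = (#{y | E x y ∧ (y, l x y) ∈ J} : ℝ) / t := by
    intro x J
    rw [Fintype.expect_eq_sum_div_card, ← Nat.cast_sum,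
      Finset.card_eq_sum_card_fiberwise (f := l x) (t := univ) (fun _ _ => mem_univ _)]
    congr 2
    refine Finset.sum_congr rfl fun k _ => ?_
    refine Finset.card_bij (fun z _ => z.1) ?_ ?_ ?_
    · rintro ⟨y, k'⟩ hz
      rw [mem_inter, hmem] at hz
      obtain ⟨⟨h1, h2, h3⟩, h4⟩ := hz
      simp only at h1 h2 h3
      subst h3
      simp only [mem_filter, mem_univ, true_and]
      exact ⟨⟨h1, by rw [h2]; exact h4⟩, h2⟩
    · rintro ⟨y, k₁⟩ h₁ ⟨y', k₂⟩ h₂ h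
      rw [mem_inter, hmem] at h₁ h₂
      exact Prod.ext h (h₁.1.2.2.trans h₂.1.2.2.symm)
    · intro y hy
      simp only [mem_filter, mem_univ, true_and] at hy
      obtain ⟨⟨h1, h2⟩, h3⟩ := hy
      refine ⟨(y, k), ?_, rfl⟩
      rw [mem_inter, hmem]
      exact ⟨⟨h1, h3, rfl⟩, h3 ▸ h2⟩
  have hfull : ∀ x, 𝔼 k, (#(N x k) : ℝ) = (#{y | E x y} : ℝ) / t := by
    intro x
    have := hcap x univ
    simpa using this
  have key := expect_exp_cover_le N (M := M) (κ := κ / t) hK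
    (fun x k => by simpa [N] using hdeg x k) (fun J hJ => by
      simp only [hcap]
      rw [← Finset.sum_div]
      exact div_le_div_of_nonneg_right (hκ J hJ) hK.le)
  simp only [hfull] at key
  rw [← Finset.sum_div, ← sub_div, div_div, ← mul_assoc, mul_comm t 2, mul_assoc, ← sq] at key
  refine le_trans (Finset.expect_le_expect fun h _ => ?_) key
  refine le_trans (le_of_eq ?_) (expect_avoid_le (univ.biUnion fun x => N x (h x)))
  refine Finset.expect_congr rfl fun g _ => congrArg ind (propext ?_)
  simp only [mem_biUnion, mem_univ, true_and, hmem, not_exists]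
  constructor
  · rintro H y x ⟨h1, h2, h3⟩
    exact H x y h1 ⟨h2.symm, h3.trans h2.symm⟩
  · rintro H x y h1 ⟨h2, h3⟩
    exact H y x ⟨h1, h2.symm, h3.trans h2.symm⟩

/-- A random function rarely maps many points into a small set of values. -/
lemma expect_concentrated_le {P A : Type*} [Fintype P] [DecidableEq P] [Fintype A]
    [DecidableEq A] (π : P → A) {m M ε s : ℝ}
    (hs : 0 ≤ s) (hm : 0 ≤ m) (hπ : ∀ a, (#{p | π p = a} : ℝ) ≤ m) :
    𝔼 f : P → K, ind (∃ I : Finset (A × K), (#I : ℝ) ≤ M ∧ ε < #{p | (π p, f p) ∈ I}) ≤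
      2 ^ (Fintype.card A * Fintype.card K) *
        Real.exp ((Real.exp s - 1) * (m * M / Fintype.card K) - s * ε) := by
  have hK : (0 : ℝ) < Fintype.card K := by exact_mod_cast Fintype.card_pos
  have hs1 : 0 ≤ Real.exp s - 1 := sub_nonneg.2 (Real.one_le_exp hs)
  have hI : ∀ I : Finset (A × K), (#I : ℝ) ≤ M →
      𝔼 f : P → K, Real.exp (s * #{p | (π p, f p) ∈ I} - s * ε) ≤
        Real.exp ((Real.exp s - 1) * (m * M / Fintype.card K) - s * ε) := by
    intro I hIM
    have hexp : ∀ q : Prop, Real.exp (s * ind q) = 1 + (Real.exp s - 1) * ind q := by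
      intro q
      by_cases hq : q
      · simp [ind_of hq]
      · simp [ind_of_not hq]
    have h1 : ∀ f : P → K, Real.exp (s * #{p | (π p, f p) ∈ I} - s * ε) =
        Real.exp (-(s * ε)) * ∏ p, (1 + (Real.exp s - 1) * ind ((π p, f p) ∈ I)) := by
      intro f
      rw [← sum_ind, Finset.mul_sum, sub_eq_add_neg, add_comm, Real.exp_add, Real.exp_sum]
      simp only [hexp]
    simp only [h1]
    rw [← Finset.mul_expect,
      expect_pi_prod (fun p k => 1 + (Real.exp s - 1) * ind ((π p, k) ∈ I)),
      sub_eq_neg_add (_ * _) (s * ε), Real.exp_add]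
    refine mul_le_mul_of_nonneg_left ?_ (Real.exp_pos _).le
    have h2 : ∀ p, 𝔼 k, (1 + (Real.exp s - 1) * ind ((π p, k) ∈ I)) ≤
        Real.exp ((Real.exp s - 1) * ((∑ k, ind ((π p, k) ∈ I)) / Fintype.card K)) := by
      intro p
      rw [Finset.expect_add_distrib, Fintype.expect_const, ← Finset.mul_expect,
        Fintype.expect_eq_sum_div_card, add_comm]
      exact Real.add_one_le_exp _
    refine le_trans (Finset.prod_le_prod (fun p _ => Finset.expect_nonneg fun k _ =>
      add_nonneg zero_le_one (mul_nonneg hs1 (ind_nonneg _))) fun p _ => h2 p) ?_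
    rw [← Real.exp_sum, ← Finset.mul_sum, ← Finset.sum_div]
    refine Real.exp_le_exp.2 (mul_le_mul_of_nonneg_left
      (div_le_div_of_nonneg_right ?_ hK.le) hs1)
    have h3 : ∑ p, ∑ k, ind ((π p, k) ∈ I) = ∑ z ∈ I, (#{p | π p = z.1} : ℝ) := by
      have : ∀ p, ∑ k, ind ((π p, k) ∈ I) = ∑ z ∈ I, ind (π p = z.1) := by
        intro p
        rw [sum_ind, sum_ind]
        norm_cast
        refine Finset.card_bij (fun k _ => (π p, k)) ?_ ?_ ?_
        · intro k hk; simpa using hk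
        · intro a _ b _ h; exact (Prod.ext_iff.1 h).2
        · rintro ⟨a, k⟩ hz
          simp only [mem_filter] at hz
          obtain ⟨hz, rfl⟩ := hz
          exact ⟨k, by simpa using hz, rfl⟩
      simp only [this]
      rw [Finset.sum_comm]
      simp only [sum_ind]
    rw [h3]
    refine le_trans (Finset.sum_le_card_nsmul _ _ m fun z _ => hπ z.1) ?_
    rw [nsmul_eq_mul, mul_comm]
    exact mul_le_mul_of_nonneg_left hIM hm
  -- Chernoff bound for each fixed `I`, then a union bound over all `I`.
  calc _ ≤ 𝔼 f : P → K, ∑ I : Finset (A × K),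
        (if (#I : ℝ) ≤ M then Real.exp (s * #{p | (π p, f p) ∈ I} - s * ε) else 0) := by
        refine Finset.expect_le_expect fun f _ => ind_le_of
          (Finset.sum_nonneg fun I _ => by split_ifs <;> positivity) ?_
        rintro ⟨I, h1, h2⟩
        refine le_trans ?_ (Finset.single_le_sum (f := fun I : Finset (A × K) =>
          if (#I : ℝ) ≤ M then Real.exp (s * #{p | (π p, f p) ∈ I} - s * ε) else 0)
          (fun I _ => by split_ifs <;> positivity) (mem_univ I))
        rw [if_pos h1]
        exact Real.one_le_exp (sub_nonneg.2 (mul_le_mul_of_nonneg_left h2.le hs))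
    _ = ∑ I : Finset (A × K), 𝔼 f : P → K,
        (if (#I : ℝ) ≤ M then Real.exp (s * #{p | (π p, f p) ∈ I} - s * ε) else 0) :=
        Finset.expect_sum_comm _ _ _
    _ ≤ ∑ I : Finset (A × K),
        Real.exp ((Real.exp s - 1) * (m * M / Fintype.card K) - s * ε) := by
        refine Finset.sum_le_sum fun I _ => ?_
        split_ifs with h
        · exact hI I h
        · rw [Fintype.expect_const]; positivity
    _ = _ := by
        rw [Finset.sum_const, Finset.card_univ, Fintype.card_finset, Fintype.card_prod,
          nsmul_eq_mul]
        push_cast; rfl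

/-- Lower tail of a sum of independent random variables with values in `[0, 1]`. -/
lemma expect_lower_tail_le {P : Type*} [Fintype P] [DecidableEq P] (w : P → K → ℝ) {c : ℝ}
    (h0 : ∀ p k, 0 ≤ w p k) (h1 : ∀ p k, w p k ≤ 1) (hc : ∀ p, c ≤ 𝔼 k, w p k) :
    𝔼 f : P → K, ind (∑ p, w p (f p) < c * Fintype.card P / 4) ≤
      Real.exp (-(c * Fintype.card P / 4)) := by
  calc _ ≤ 𝔼 f : P → K, Real.exp (c * Fintype.card P / 4) * ∏ p, Real.exp (-w p (f p)) := by
        refine Finset.expect_le_expect fun f _ => ind_le_of (by positivity) fun h => ?_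
        rw [← Real.exp_sum, ← Real.exp_add, Finset.sum_neg_distrib]
        exact Real.one_le_exp (by linarith)
    _ = Real.exp (c * Fintype.card P / 4) * ∏ p, 𝔼 k, Real.exp (-w p k) := by
        rw [← Finset.mul_expect, expect_pi_prod (fun p k => Real.exp (-w p k))]
    _ ≤ Real.exp (c * Fintype.card P / 4) * ∏ _p : P, Real.exp (-c / 2) := by
        refine mul_le_mul_of_nonneg_left (Finset.prod_le_prod
          (fun p _ => Finset.expect_nonneg fun k _ => (Real.exp_pos _).le) fun p _ => ?_)
          (Real.exp_pos _).le
        refine (expect_exp_neg_le _ (h0 p) (h1 p)).trans (Real.exp_le_exp.2 ?_)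
        linarith [hc p]
    _ = _ := by
        rw [Finset.prod_const, Finset.card_univ, ← Real.exp_nat_mul, ← Real.exp_add]
        congr 1; ring

end

/-! ### Monochromatic rainbow triangles across three `m`-sets -/

section

open scoped Classical

lemma card_filter_snd_eq {B D : Type*} [Fintype B] [Fintype D] [DecidableEq D] (d : D)
    (Q : B → Prop) {dec : DecidablePred fun y : B × D => d = y.2 ∧ Q y.1} :
    (#{y : B × D | d = y.2 ∧ Q y.1} : ℝ) = ∑ b, ind (Q b) := by
  rw [sum_ind]
  norm_cast
  refine Finset.card_bij (fun y _ => y.1) ?_ ?_ ?_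
  · rintro ⟨b, d'⟩ h
    simp only [mem_filter, mem_univ, true_and] at h ⊢
    exact h.2
  · rintro ⟨b, d'⟩ h ⟨b', d''⟩ h' e
    simp only [mem_filter, mem_univ, true_and] at h h' e
    rw [e, ← h.1, ← h'.1]
  · intro b h
    exact ⟨(b, d), by simpa using h, rfl⟩

variable {K : Type*} [Fintype K] [Nonempty K] {m : ℕ}

/-- The sets of pairs are evenly spread by `f`, and sufficiently many triples are compatible with
`f`. -/
structure Typical (K₀ : ℝ) (W : Fin m → Fin m → Fin m → K → Prop) (f : Fin m × Fin m → K) :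
    Prop where
  left : ∀ I : Finset (Fin m × K), (#I : ℝ) ≤ m * Fintype.card K / K₀ →
    (#{p : Fin m × Fin m | (p.1, f p) ∈ I} : ℝ) ≤ m ^ 2 / 240
  right : ∀ I : Finset (Fin m × K), (#I : ℝ) ≤ m * Fintype.card K / K₀ →
    (#{p : Fin m × Fin m | (p.2, f p) ∈ I} : ℝ) ≤ m ^ 2 / 240
  many : (m : ℝ) ^ 3 / 40 ≤ ∑ p : Fin m × Fin m, (#{d | W p.1 p.2 d (f p)} : ℝ)

/-- Double counting: every heavy pair uses more than `#K` of the `m ^ 2` positions. Discarding heavy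
pairs yields the degree bound required by `expect_no_match_le`. -/
lemma card_heavy_le {K₀ : ℝ} (f : Fin m × Fin m → K) (h1 : m * K₀ ≤ (Fintype.card K : ℝ) ^ 2)
    (hK₀ : 0 < K₀) :
    (#{z : Fin m × K | Fintype.card K < #{b | f (z.1, b) = z.2}} : ℝ) ≤
      m * Fintype.card K / K₀ := by
  have hK : (0 : ℝ) < Fintype.card K := by exact_mod_cast Fintype.card_pos
  set H : Finset (Fin m × K) := {z : Fin m × K | Fintype.card K < #{b | f (z.1, b) = z.2}}
  have h2 : (#H : ℝ) * Fintype.card K ≤ (m : ℝ) ^ 2 := by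
    have h3 : #H * Fintype.card K ≤ ∑ z ∈ H, #{b | f (z.1, b) = z.2} := by
      rw [← smul_eq_mul]
      exact Finset.card_nsmul_le_sum _ _ _ fun z hz => (mem_filter.1 hz).2.le
    have h4 : ∑ z ∈ H, #{b | f (z.1, b) = z.2} ≤ ∑ z : Fin m × K, #{b | f (z.1, b) = z.2} :=
      Finset.sum_le_sum_of_subset (subset_univ _)
    have h5 : ∑ z : Fin m × K, #{b | f (z.1, b) = z.2} = m ^ 2 := by
      rw [Fintype.sum_prod_type]
      have : ∀ a : Fin m, ∑ k, #{b | f (a, b) = k} = m := fun a => by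
        rw [← Finset.card_eq_sum_card_fiberwise (f := fun b => f (a, b)) (s := univ) (t := univ)
          (fun _ _ => mem_univ _), Finset.card_univ, Fintype.card_fin]
      simp only [this, sum_const, Finset.card_univ, Fintype.card_fin, smul_eq_mul, sq]
    exact_mod_cast h3.trans (h4.trans_eq h5)
  rw [le_div_iff₀ hK₀]
  by_contra hcon
  push Not at hcon
  have h6 : (m : ℝ) * Fintype.card K * Fintype.card K < #H * K₀ * Fintype.card K :=
    mul_lt_mul_of_pos_right hcon hK
  have h7 : #H * K₀ * Fintype.card K ≤ (m : ℝ) ^ 2 * K₀ := by nlinarith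
  have h8 : (m : ℝ) * (m * K₀) ≤ m * (Fintype.card K : ℝ) ^ 2 :=
    mul_le_mul_of_nonneg_left h1 (Nat.cast_nonneg m)
  nlinarith

/-- Slice `J` by `d`. Small slices are controlled by `Typical.right`; large ones are few, and for
them the trivial bound `m ^ 2` is enough. This bounds the overlap in `expect_no_match_le`. -/
lemma sum_card_slice_le {K₀ : ℝ} (hK₀ : 0 < K₀) (hm : 0 < m)
    {W : Fin m → Fin m → Fin m → K → Prop} {f : Fin m × Fin m → K} (hf : Typical K₀ W f)
    (J : Finset ((Fin m × Fin m) × K))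
    (hJ : (#J : ℝ) ≤ m / 240 * (m * Fintype.card K / K₀)) :
    ∑ d, (#{p : Fin m × Fin m | ((p.2, d), f p) ∈ J} : ℝ) ≤ (m : ℝ) ^ 3 / 120 := by
  have hK : (0 : ℝ) < Fintype.card K := by exact_mod_cast Fintype.card_pos
  have hm' : (0 : ℝ) < m := by exact_mod_cast hm
  set M : ℝ := m * Fintype.card K / K₀
  have hM : 0 < M := by positivity
  let S : Fin m → Finset (Fin m × K) := fun d => {z | ((z.1, d), z.2) ∈ J}
  have hS : ∑ d, (#(S d) : ℝ) = #J := by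
    rw [← Nat.cast_sum, Finset.card_eq_sum_card_fiberwise (f := fun z => z.1.2) (t := univ)
      (fun _ _ => mem_univ _)]
    congr 1
    refine Finset.sum_congr rfl fun d _ => ?_
    refine Finset.card_bij (fun z _ => ((z.1, d), z.2)) ?_ ?_ ?_
    · intro z hz
      simpa [S] using hz
    · rintro ⟨b, k⟩ _ ⟨b', k'⟩ _ h
      simp only [Prod.mk.injEq] at h
      rw [h.1.1, h.2]
    · rintro ⟨⟨b, d'⟩, k⟩ hz
      simp only [mem_filter] at hz
      obtain ⟨hz, rfl⟩ := hz
      exact ⟨(b, k), by simpa [S] using hz, rfl⟩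
  have hd : ∀ d, (#{p : Fin m × Fin m | ((p.2, d), f p) ∈ J} : ℝ) ≤
      (m : ℝ) ^ 2 / 240 + (m : ℝ) ^ 2 * (#(S d) / M) := by
    intro d
    by_cases h : (#(S d) : ℝ) ≤ M
    · have := hf.right (S d) h
      simp only [S, mem_filter, mem_univ, true_and] at this
      refine this.trans (le_add_of_nonneg_right (by positivity))
    · have h1 : (1 : ℝ) ≤ #(S d) / M := (one_le_div hM).2 (le_of_not_ge h)
      have h2 : (#{p : Fin m × Fin m | ((p.2, d), f p) ∈ J} : ℝ) ≤ (m : ℝ) ^ 2 := by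
        have := Finset.card_le_univ ({p : Fin m × Fin m | ((p.2, d), f p) ∈ J} : Finset _)
        simp only [Fintype.card_prod, Fintype.card_fin, ← sq] at this
        exact_mod_cast this
      nlinarith [sq_nonneg (m : ℝ)]
  calc _ ≤ ∑ d : Fin m, ((m : ℝ) ^ 2 / 240 + (m : ℝ) ^ 2 * (#(S d) / M)) :=
        Finset.sum_le_sum fun d _ => hd d
    _ = (m : ℝ) ^ 3 / 240 + (m : ℝ) ^ 2 * (#J / M) := by
        rw [Finset.sum_add_distrib, Finset.sum_const, ← Finset.mul_sum, ← Finset.sum_div, hS,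
          Finset.card_univ, Fintype.card_fin, nsmul_eq_mul]
        ring
    _ ≤ (m : ℝ) ^ 3 / 240 + (m : ℝ) ^ 2 * (m / 240) := by
        have : #J / M ≤ (m : ℝ) / 240 := (div_le_iff₀ hM).2 hJ
        gcongr
    _ = _ := by ring

lemma expect_no_triangle_of_typical {K₀ : ℝ} (hK₀ : 0 < K₀) (hm : 0 < m)
    {W : Fin m → Fin m → Fin m → K → Prop} {f : Fin m × Fin m → K} (hf : Typical K₀ W f)
    (h1 : m * K₀ ≤ (Fintype.card K : ℝ) ^ 2)
    (h2 : 16 * (Fintype.card K : ℝ) ^ 3 ≤ (m : ℝ) ^ 2)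
    (h3 : 24 * K₀ * Fintype.card K ≤ m) :
    𝔼 h : Fin m × Fin m → K, 𝔼 g : Fin m × Fin m → K, ind (∀ a b d, W a b d (f (a, b)) →
      ¬(h (a, d) = f (a, b) ∧ g (b, d) = f (a, b))) ≤
      2 * Real.exp (-(m * Fintype.card K / 10)) := by
  have hK : (0 : ℝ) < Fintype.card K := by exact_mod_cast Fintype.card_pos
  have hm' : (0 : ℝ) < m := by exact_mod_cast hm
  set t : ℝ := (Fintype.card K : ℝ) with ht
  set H : Finset (Fin m × K) := {z : Fin m × K | Fintype.card K < #{b | f (z.1, b) = z.2}} with hH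
  -- Join `(a, d)` to `(b, d)` when colour `f (a, b)` makes the triple rainbow and is not heavy at
  -- `a`; a match at both ends is a red triangle.
  let E : Fin m × Fin m → Fin m × Fin m → Prop := fun x y =>
    x.2 = y.2 ∧ W x.1 y.1 x.2 (f (x.1, y.1)) ∧ (x.1, f (x.1, y.1)) ∉ H
  have key := expect_no_match_le E (fun x y => f (x.1, y.1)) (M := m / 240 * (m * t / K₀))
    (κ := (m : ℝ) ^ 3 / 120) ?_ ?_
  · refine (le_trans (Finset.expect_le_expect fun h _ => Finset.expect_le_expect fun g _ =>
      ind_le_of (ind_nonneg _) fun hh => (ind_of ?_).ge) key).trans ?_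
    · rintro ⟨a, d⟩ ⟨b, d'⟩ ⟨h4, h5, -⟩
      simp only at h4 h5
      subst h4
      exact hh a b d h5
    · have he : (m : ℝ) ^ 3 / 40 - (m : ℝ) ^ 3 / 240 ≤
          ∑ x, (#{y | E x y} : ℝ) := by
        have e1 : ∀ x : Fin m × Fin m, (#{y | E x y} : ℝ) =
            ∑ b, ind (W x.1 b x.2 (f (x.1, b)) ∧ (x.1, f (x.1, b)) ∉ H) := by
          intro x
          simp only [E]
          rw [card_filter_snd_eq x.2 (fun b => W x.1 b x.2 (f (x.1, b)) ∧
            (x.1, f (x.1, b)) ∉ H)]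
        have e2 : ∀ p q : Prop, ind p - ind q ≤ ind (p ∧ ¬q) := by
          intro p q
          by_cases hp : p <;> by_cases hq : q <;> simp [ind, hp, hq]
        have e3 := hf.many
        have e4 := hf.left H (card_heavy_le f h1 hK₀)
        calc _ ≤ ∑ p : Fin m × Fin m, (#{d | W p.1 p.2 d (f p)} : ℝ) -
              m * (#{p : Fin m × Fin m | (p.1, f p) ∈ H} : ℝ) := by nlinarith
          _ = ∑ a, ∑ b, ∑ d, (ind (W a b d (f (a, b))) - ind ((a, f (a, b)) ∈ H)) := by
              simp only [← sum_ind, Fintype.sum_prod_type, Finset.sum_sub_distrib,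
                Finset.sum_const, Finset.card_univ, Fintype.card_fin, nsmul_eq_mul,
                Finset.mul_sum]
          _ ≤ ∑ a, ∑ b, ∑ d, ind (W a b d (f (a, b)) ∧ (a, f (a, b)) ∉ H) :=
              Finset.sum_le_sum fun a _ => Finset.sum_le_sum fun b _ =>
                Finset.sum_le_sum fun d _ => e2 _ _
          _ = _ := by
              simp only [e1, Fintype.sum_prod_type]
              exact Finset.sum_congr rfl fun a _ => Finset.sum_comm
      have b1 : Real.exp (-(m / 240 * (m * t / K₀)) / t) ≤ Real.exp (-(m * t / 10)) := by
        refine Real.exp_le_exp.2 ?_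
        rw [neg_div, neg_le_neg_iff]
        have : (m : ℝ) / 240 * (m * t / K₀) / t = m * m / (240 * K₀) := by field_simp
        rw [this, le_div_iff₀ (by positivity)]
        nlinarith
      -- The numerator is at most `-m ^ 3 / 80`, since `1/40 - 1/240 - 1/120 = 1/80`; `16 * t ^ 3 ≤
      -- m ^ 2` then gives the exponent.
      have b2 : Real.exp (((m : ℝ) ^ 3 / 120 - ∑ x, (#{y | E x y} : ℝ)) / (2 * t ^ 2)) ≤
          Real.exp (-(m * t / 10)) := by
        refine Real.exp_le_exp.2 ?_
        rw [div_le_iff₀ (by positivity)]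
        nlinarith
      convert (add_le_add b1 b2).trans_eq (two_mul _).symm
  · rintro ⟨a, d⟩ k
    simp only [E]
    simp only [and_assoc]
    rw [card_filter_snd_eq d (fun b => W a b d (f (a, b)) ∧ (a, f (a, b)) ∉ H ∧ f (a, b) = k),
      sum_ind]
    by_cases hk : (a, k) ∈ H
    · rw [Finset.filter_false_of_mem]
      · simp
      · rintro b - ⟨-, h5, h6⟩
        exact h5 (h6 ▸ hk)
    · refine Nat.cast_le.2 (le_trans (Finset.card_le_card (t := {b | f (a, b) = k}) ?_) ?_)
      · intro b
        simp only [mem_filter, mem_univ, true_and]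
        exact fun h => h.2.2
      · simpa [hH] using hk
  · intro J hJ
    refine le_trans ?_ (sum_card_slice_le hK₀ hm hf J hJ)
    calc _ ≤ ∑ x : Fin m × Fin m, ∑ b, ind (((b, x.2), f (x.1, b)) ∈ J) := by
          refine Finset.sum_le_sum fun x _ => ?_
          rw [← card_filter_snd_eq x.2 (fun b => ((b, x.2), f (x.1, b)) ∈ J)
            (dec := fun _ => inferInstance)]
          refine Nat.cast_le.2 (Finset.card_le_card ?_)
          intro y
          simp only [E, mem_filter, mem_univ, true_and]
          exact fun h => ⟨h.1.1, by rw [h.1.1]; exact h.2⟩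
      _ = _ := by
          simp only [← sum_ind, Fintype.sum_prod_type]
          rw [Finset.sum_comm]

lemma expect_not_typical_le (hm : 0 < m) (W : Fin m → Fin m → Fin m → K → Prop)
    (hW : ∀ a b d, (Fintype.card K : ℝ) / 10 ≤ #{k | W a b d k})
    (h : 4 * (Fintype.card K : ℝ) ≤ m) :
    𝔼 f : Fin m × Fin m → K, ind (¬Typical (Real.exp 480) W f) ≤
      3 * Real.exp (-(m * Fintype.card K / 10)) := by
  have hK : (0 : ℝ) < Fintype.card K := by exact_mod_cast Fintype.card_pos
  have hm' : (0 : ℝ) < m := by exact_mod_cast hm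
  set t : ℝ := (Fintype.card K : ℝ) with ht
  set K₀ : ℝ := Real.exp 480 with hK₀
  have hK₀' : 0 < K₀ := Real.exp_pos _
  have hR : ∀ π : Fin m × Fin m → Fin m, (∀ a, (#{p | π p = a} : ℝ) ≤ m) →
      𝔼 f : Fin m × Fin m → K, ind (∃ I : Finset (Fin m × K), (#I : ℝ) ≤ m * t / K₀ ∧
        (m : ℝ) ^ 2 / 240 < #{p | (π p, f p) ∈ I}) ≤ Real.exp (-(m * t / 10)) := by
    intro π hπ
    -- With `s = 480` and `K₀ = exp 480` the exponent is at most `m ^ 2 - 2 * m ^ 2`, which absorbs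
    -- the `2 ^ (m * t)` choices of `I`.
    refine (expect_concentrated_le π (s := 480) (by norm_num) hm'.le hπ).trans ?_
    rw [Fintype.card_fin]
    have h2 : (2 : ℝ) ^ (m * Fintype.card K) ≤ Real.exp (m * t) := by
      have : (2 : ℝ) ≤ Real.exp 1 := by linarith [Real.add_one_le_exp (1 : ℝ)]
      refine (pow_le_pow_left₀ (by norm_num) this _).trans ?_
      rw [← Real.exp_nat_mul]
      push_cast
      rw [mul_one]
    refine (mul_le_mul_of_nonneg_right h2 (Real.exp_pos _).le).trans ?_
    rw [← Real.exp_add]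
    refine Real.exp_le_exp.2 ?_
    have h3 : (K₀ - 1) * (m * (m * t / K₀) / t) ≤ (m : ℝ) ^ 2 := by
      have : (m : ℝ) * (m * t / K₀) / t = (m : ℝ) ^ 2 / K₀ := by field_simp
      rw [this, sub_mul, mul_div_cancel₀ _ hK₀'.ne']
      have : 0 ≤ (m : ℝ) ^ 2 / K₀ := by positivity
      linarith
    nlinarith
  have hA := hR Prod.fst (fun a => by
    have : #{p : Fin m × Fin m | p.1 = a} = m := by
      rw [show ({p : Fin m × Fin m | p.1 = a} : Finset _) = {a} ×ˢ univ by
      ext ⟨x, y⟩; simp [eq_comm]]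
      simp
    rw [this])
  have hB := hR Prod.snd (fun a => by
    have : #{p : Fin m × Fin m | p.2 = a} = m := by
      rw [show ({p : Fin m × Fin m | p.2 = a} : Finset _) = univ ×ˢ {a} by
      ext ⟨x, y⟩; simp [eq_comm]]
      simp
    rw [this])
  have hV := expect_lower_tail_le (P := Fin m × Fin m) (K := K)
    (fun p k => (#{d | W p.1 p.2 d k} : ℝ) / m) (c := 1 / 10) (fun p k => by positivity)
    (fun p k => by
      refine div_le_one_of_le₀ ?_ hm'.le
      have := Finset.card_le_univ ({d | W p.1 p.2 d k} : Finset (Fin m))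
      rw [Fintype.card_fin] at this
      exact_mod_cast this)
    (fun p => by
      rw [← Finset.expect_div, le_div_iff₀ hm', Fintype.expect_eq_sum_div_card, ← ht,
        le_div_iff₀ hK]
      have : ∑ k, (#{d | W p.1 p.2 d k} : ℝ) = ∑ d, (#{k | W p.1 p.2 d k} : ℝ) := by
        simp only [← sum_ind]
        exact Finset.sum_comm
      rw [this]
      calc (1 / 10 * m * t : ℝ) = ∑ _d : Fin m, t / 10 := by
            rw [Finset.sum_const, Finset.card_univ, Fintype.card_fin, nsmul_eq_mul]; ring
        _ ≤ _ := Finset.sum_le_sum fun d _ => hW _ _ d)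
  have hV' : Real.exp (-(1 / 10 * (Fintype.card (Fin m × Fin m) : ℝ) / 4)) ≤
      Real.exp (-(m * t / 10)) := by
    rw [Fintype.card_prod, Fintype.card_fin]
    push_cast
    refine Real.exp_le_exp.2 ?_
    nlinarith
  refine le_trans ?_ ((add_le_add (add_le_add hA hB) (hV.trans hV')).trans_eq (by ring))
  rw [← Finset.expect_add_distrib, ← Finset.expect_add_distrib]
  refine Finset.expect_le_expect fun f _ => ind_le_of
    (add_nonneg (add_nonneg (ind_nonneg _) (ind_nonneg _)) (ind_nonneg _)) fun hf => ?_
  by_contra hcon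
  push Not at hcon
  have hp : ∀ p q r : Prop, ind p + ind q + ind r < 1 → ¬p ∧ ¬q ∧ ¬r := by
    intro p q r hlt
    refine ⟨fun hp => ?_, fun hp => ?_, fun hp => ?_⟩ <;> rw [ind_of hp] at hlt <;>
      linarith [ind_nonneg p, ind_nonneg q, ind_nonneg r]
  obtain ⟨c1, c2, c3⟩ := hp _ _ _ hcon
  push Not at c1 c2 c3
  refine hf ⟨c1, c2, ?_⟩
  rw [← Finset.sum_div, Fintype.card_prod, Fintype.card_fin, le_div_iff₀ hm'] at c3
  push_cast at c3
  refine le_trans (le_of_eq (by ring)) c3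

lemma expect_no_triangle_le (hm : 0 < m) (W : Fin m → Fin m → Fin m → K → Prop)
    (hW : ∀ a b d, (Fintype.card K : ℝ) / 10 ≤ #{k | W a b d k})
    (h1 : m * Real.exp 480 ≤ (Fintype.card K : ℝ) ^ 2)
    (h2 : 16 * (Fintype.card K : ℝ) ^ 3 ≤ (m : ℝ) ^ 2)
    (h3 : 24 * Real.exp 480 * Fintype.card K ≤ m) :
    𝔼 f : Fin m × Fin m → K, 𝔼 h : Fin m × Fin m → K, 𝔼 g : Fin m × Fin m → K,
      ind (∀ a b d, W a b d (f (a, b)) → ¬(h (a, d) = f (a, b) ∧ g (b, d) = f (a, b))) ≤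
      5 * Real.exp (-(m * Fintype.card K / 10)) := by
  have hK : (0 : ℝ) < Fintype.card K := by exact_mod_cast Fintype.card_pos
  have hT := expect_not_typical_le hm W hW (by
    nlinarith [Real.add_one_le_exp (480 : ℝ)])
  rw [show (5 : ℝ) = 3 + 2 by norm_num, add_mul]
  refine le_trans ?_ (add_le_add_left hT _)
  rw [← Fintype.expect_const (ι := Fin m × Fin m → K)
    (2 * Real.exp (-(m * Fintype.card K / 10)) : ℝ), ← Finset.expect_add_distrib]
  refine Finset.expect_le_expect fun f _ => ?_
  by_cases hf : Typical (Real.exp 480) W f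
  · exact le_add_of_nonneg_of_le (ind_nonneg _)
      (expect_no_triangle_of_typical (Real.exp_pos _) hm hf h1 h2 h3)
  · refine le_add_of_le_of_nonneg ?_ (by positivity)
    rw [ind_of hf, ← Fintype.expect_const (ι := Fin m × Fin m → K) (1 : ℝ)]
    refine Finset.expect_le_expect fun h _ => ?_
    rw [← Fintype.expect_const (ι := Fin m × Fin m → K) (1 : ℝ)]
    exact Finset.expect_le_expect fun g _ => ind_le_one _

end

/-! ### Random labellings and the pair colouring -/

section

open scoped Classical

/-- The label function `l` separates the three vertices. -/
def Rainbow {V : Type*} (l : V → Fin 3) (a b d : V) : Prop :=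
  l a ≠ l b ∧ l a ≠ l d ∧ l b ≠ l d

lemma expect_rainbow {V : Type*} [Fintype V] [DecidableEq V] {a b d : V} (hab : a ≠ b)
    (had : a ≠ d) (hbd : b ≠ d) : 𝔼 l : V → Fin 3, ind (Rainbow l a b d) = 2 / 9 := by
  have hφ : Function.Injective ![a, b, d] := by
    intro i j
    fin_cases i <;> fin_cases j <;> simp [hab, had, hbd, hab.symm, had.symm, hbd.symm]
  have h := expect_comp_injective (K := Fin 3) hφ
    (fun x => ind (x 0 ≠ x 1 ∧ x 0 ≠ x 2 ∧ x 1 ≠ x 2))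
  refine h.trans ?_
  have hcard : #{x : Fin 3 → Fin 3 | x 0 ≠ x 1 ∧ x 0 ≠ x 2 ∧ x 1 ≠ x 2} = 6 := by
    decide +kernel
  rw [expect_ind, hcard]
  norm_num

/-- First moment: a triple is rainbow with probability `2 / 9`, so each label contributes the factor
`1 - 1 / 9` on average. Each summand is at most the sum over all triples. -/
lemma exists_labels_pow {V : Type*} [Fintype V] (t : ℕ) :
    ∃ l : Fin t → V → Fin 3, ∀ a b d, a ≠ b → a ≠ d → b ≠ d →
      (1 / 2 : ℝ) ^ #{i | Rainbow (l i) a b d} ≤ (Fintype.card V : ℝ) ^ 3 * (8 / 9) ^ t := by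
  have hpow : ∀ (l : Fin t → V → Fin 3) (a b d : V),
      (1 / 2 : ℝ) ^ #{i | Rainbow (l i) a b d} = ∏ i, (1 - ind (Rainbow (l i) a b d) / 2) := by
    intro l a b d
    rw [← Finset.prod_const, Finset.prod_filter]
    refine Finset.prod_congr rfl fun i _ => ?_
    by_cases h : Rainbow (l i) a b d
    · rw [if_pos h, ind_of h]; norm_num
    · rw [if_neg h, ind_of_not h]; norm_num
  let T : Finset (V × V × V) := {z | z.1 ≠ z.2.1 ∧ z.1 ≠ z.2.2 ∧ z.2.1 ≠ z.2.2}
  obtain ⟨l, -, hl⟩ := Finset.exists_le_of_expect_le univ_nonempty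
    (a := (Fintype.card V : ℝ) ^ 3 * (8 / 9) ^ t) (f := fun l : Fin t → V → Fin 3 =>
      ∑ z ∈ T, ∏ i, (1 - ind (Rainbow (l i) z.1 z.2.1 z.2.2) / 2)) (by
    rw [Finset.expect_sum_comm]
    calc _ = ∑ z ∈ T, (8 / 9 : ℝ) ^ t := by
          refine Finset.sum_congr rfl fun z hz => ?_
          obtain ⟨h1, h2, h3⟩ := (mem_filter.1 hz).2
          rw [expect_pi_prod (fun (_ : Fin t) (l : V → Fin 3) =>
            1 - ind (Rainbow l z.1 z.2.1 z.2.2) / 2)]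
          simp only [Finset.expect_sub_distrib, Fintype.expect_const, ← Finset.expect_div,
            expect_rainbow h1 h2 h3, Finset.prod_const, Finset.card_univ, Fintype.card_fin]
          norm_num
      _ ≤ _ := by
          rw [Finset.sum_const, nsmul_eq_mul]
          refine mul_le_mul_of_nonneg_right ?_ (by positivity)
          have := Finset.card_le_univ T
          simp only [Fintype.card_prod] at this
          calc (#T : ℝ) ≤ ((Fintype.card V * (Fintype.card V * Fintype.card V) : ℕ) : ℝ) :=
                Nat.cast_le.2 this
            _ = _ := by push_cast; ring)
  refine ⟨l, fun a b d hab had hbd => ?_⟩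
  rw [hpow]
  refine le_trans ?_ hl
  refine Finset.single_le_sum (f := fun z : V × V × V =>
    ∏ i, (1 - ind (Rainbow (l i) z.1 z.2.1 z.2.2) / 2)) (fun z _ => ?_)
    (show (a, b, d) ∈ T from mem_filter.2 ⟨mem_univ _, hab, had, hbd⟩)
  exact Finset.prod_nonneg fun i _ => by
    linarith [ind_le_one (Rainbow (l i) z.1 z.2.1 z.2.2)]

lemma exists_labels {V : Type*} [Fintype V] [Nonempty V] {t : ℕ}
    (ht : 100 * Real.log (Fintype.card V) ≤ t) :
    ∃ l : Fin t → V → Fin 3, ∀ a b d, a ≠ b → a ≠ d → b ≠ d →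
      (t : ℝ) / 10 ≤ #{i | Rainbow (l i) a b d} := by
  obtain ⟨l, hl⟩ := exists_labels_pow (V := V) t
  refine ⟨l, fun a b d hab had hbd => ?_⟩
  have hV : (0 : ℝ) < Fintype.card V := by exact_mod_cast Fintype.card_pos
  have h := Real.log_le_log (by positivity) (hl a b d hab had hbd)
  rw [Real.log_mul (by positivity) (by positivity), Real.log_pow, Real.log_pow, Real.log_pow,
    one_div, Real.log_inv] at h
  have h1 : Real.log (8 / 9) ≤ -(1 / 9) := by
    have := Real.log_le_sub_one_of_pos (show (0 : ℝ) < 8 / 9 by norm_num)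
    linarith
  have h2 : Real.log 2 < 0.7 := Real.log_two_lt_d9.trans (by norm_num)
  have h3 : (t : ℝ) * Real.log (8 / 9) ≤ t * (-(1 / 9)) :=
    mul_le_mul_of_nonneg_left h1 (Nat.cast_nonneg t)
  have h4 : (#{i | Rainbow (l i) a b d} : ℝ) * Real.log 2 ≤ #{i | Rainbow (l i) a b d} * 0.7 :=
    mul_le_mul_of_nonneg_left h2.le (Nat.cast_nonneg _)
  push_cast at h
  have h5 : (0 : ℝ) ≤ t := Nat.cast_nonneg t
  linarith

/-- A fixed system of three disjoint `m`-sets is unlikely to contain no monochromatic rainbow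
triangle. -/
lemma expect_no_mono_triangle_le {V : Type*} [Fintype V] [DecidableEq V] {t m : ℕ} (ht : 0 < t)
    (hm : 0 < m) {l : Fin t → V → Fin 3} (hl : ∀ a b d, a ≠ b → a ≠ d → b ≠ d →
      (t : ℝ) / 10 ≤ #{i | Rainbow (l i) a b d})
    (h1 : m * Real.exp 480 ≤ (t : ℝ) ^ 2) (h2 : 16 * (t : ℝ) ^ 3 ≤ (m : ℝ) ^ 2)
    (h3 : 24 * Real.exp 480 * t ≤ m) {σ : Fin 3 × Fin m → V} (hσ : Function.Injective σ) :
    𝔼 c : Sym2 V → Fin t, ind (∀ a b d i, Rainbow (l i) (σ (0, a)) (σ (1, b)) (σ (2, d)) →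
      ¬(c s(σ (0, a), σ (1, b)) = i ∧ c s(σ (0, a), σ (2, d)) = i ∧
        c s(σ (1, b), σ (2, d)) = i)) ≤ 5 * Real.exp (-(m * t / 10)) := by
  have : Nonempty (Fin t) := ⟨⟨0, ht⟩⟩
  -- The pairs between the three sets are distinct, so their colours form three independent random
  -- functions.
  let φ : (Fin m × Fin m) ⊕ ((Fin m × Fin m) ⊕ (Fin m × Fin m)) → Sym2 V :=
    Sum.elim (fun p => s(σ (0, p.1), σ (1, p.2)))
      (Sum.elim (fun p => s(σ (0, p.1), σ (2, p.2))) (fun p => s(σ (1, p.1), σ (2, p.2))))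
  have hφ : Function.Injective φ := by
    rintro (⟨a, b⟩ | ⟨a, b⟩ | ⟨a, b⟩) (⟨a', b'⟩ | ⟨a', b'⟩ | ⟨a', b'⟩) h <;>
      simp [φ, hσ.eq_iff] at h ⊢ <;> exact h
  have key := expect_no_triangle_le (K := Fin t) hm
    (fun a b d i => Rainbow (l i) (σ (0, a)) (σ (1, b)) (σ (2, d)))
    (fun a b d => by
      rw [Fintype.card_fin]
      exact hl _ _ _ (hσ.ne (by simp)) (hσ.ne (by simp)) (hσ.ne (by simp)))
    (by rwa [Fintype.card_fin]) (by rwa [Fintype.card_fin]) (by rwa [Fintype.card_fin])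
  rw [Fintype.card_fin] at key
  refine le_trans (le_of_eq ?_) key
  have e := expect_comp_injective (K := Fin t) hφ (fun x => ind (∀ a b d,
    Rainbow (l (x (Sum.inl (a, b)))) (σ (0, a)) (σ (1, b)) (σ (2, d)) →
      ¬(x (Sum.inr (Sum.inl (a, d))) = x (Sum.inl (a, b)) ∧
        x (Sum.inr (Sum.inr (b, d))) = x (Sum.inl (a, b)))))
  rw [expect_sum_arrow] at e
  simp only [expect_sum_arrow (I := Fin m × Fin m) (J := Fin m × Fin m), Sum.elim_inl,
    Sum.elim_inr] at e
  rw [← e]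
  refine Finset.expect_congr rfl fun c _ => congrArg ind (propext ?_)
  simp only [φ, Function.comp_apply, Sum.elim_inl, Sum.elim_inr]
  constructor
  · rintro H a b d hr ⟨h4, h5⟩
    exact H a b d _ hr ⟨rfl, h4, h5⟩
  · rintro H a b d i hr ⟨rfl, h4, h5⟩
    exact H a b d hr ⟨h4, h5⟩

/-- A colouring of the pairs, together with one labelling of the vertices for each colour, such
that every `3m` vertices span a triangle in one colour which is rainbow in the corresponding
labelling. -/
lemma exists_pair_coloring {V : Type*} [Fintype V] [Nonempty V] [DecidableEq V] {t m : ℕ}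
    (ht : 100 * Real.log (Fintype.card V) ≤ t) (hmt : 100 ≤ m * t)
    (h1 : m * Real.exp 480 ≤ (t : ℝ) ^ 2) (h2 : 16 * (t : ℝ) ^ 3 ≤ (m : ℝ) ^ 2)
    (h3 : 24 * Real.exp 480 * t ≤ m) :
    ∃ (l : Fin t → V → Fin 3) (c : Sym2 V → Fin t), ∀ σ : Fin 3 × Fin m → V,
      Function.Injective σ → ∃ a b d i, Rainbow (l i) (σ (0, a)) (σ (1, b)) (σ (2, d)) ∧
        c s(σ (0, a), σ (1, b)) = i ∧ c s(σ (0, a), σ (2, d)) = i ∧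
        c s(σ (1, b), σ (2, d)) = i := by
  have ht0 : 0 < t := Nat.pos_of_ne_zero fun h => by simp [h] at hmt
  have hm0 : 0 < m := Nat.pos_of_ne_zero fun h => by simp [h] at hmt
  have : Nonempty (Fin t) := ⟨⟨0, ht0⟩⟩
  obtain ⟨l, hl⟩ := exists_labels ht
  let bad : (Fin 3 × Fin m → V) → (Sym2 V → Fin t) → Prop := fun σ c => ∀ a b d i,
    Rainbow (l i) (σ (0, a)) (σ (1, b)) (σ (2, d)) →
      ¬(c s(σ (0, a), σ (1, b)) = i ∧ c s(σ (0, a), σ (2, d)) = i ∧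
        c s(σ (1, b), σ (2, d)) = i)
  obtain ⟨c, -, hc⟩ := Finset.exists_le_of_expect_le univ_nonempty
    (f := fun c => ∑ σ : Fin 3 × Fin m → V,
      ind (Function.Injective σ ∧ bad σ c))
    (a := (Fintype.card V : ℝ) ^ (3 * m) * (5 * Real.exp (-(m * t / 10)))) (by
    rw [Finset.expect_sum_comm]
    refine (Finset.sum_le_card_nsmul _ _ (5 * Real.exp (-(m * t / 10))) fun σ _ => ?_).trans ?_
    · by_cases hσ : Function.Injective σ
      · simp only [hσ, true_and]
        exact expect_no_mono_triangle_le ht0 hm0 hl h1 h2 h3 hσ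
      · simp only [hσ, false_and, ind_of_not not_false, Finset.expect_const_zero]
        positivity
    · rw [Finset.card_univ, Fintype.card_fun, nsmul_eq_mul]
      simp)
  refine ⟨l, c, fun σ hσ => ?_⟩
  by_contra hcon
  have hbad : bad σ c := by
    intro a b d i hr hi
    exact hcon ⟨a, b, d, i, hr, hi⟩
  have hone : (1 : ℝ) ≤ ∑ σ : Fin 3 × Fin m → V, ind (Function.Injective σ ∧ bad σ c) := by
    rw [← ind_of (p := Function.Injective σ ∧ bad σ c) ⟨hσ, hbad⟩]
    exact Finset.single_le_sum (f := fun σ => ind (Function.Injective σ ∧ bad σ c))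
      (fun σ _ => ind_nonneg _) (mem_univ σ)
  -- The factor `N ^ (3 * m)` costs `3 * m * t / 100` in the exponent, leaving `7 * m * t / 100` to
  -- beat `5`.
  have hlt : (Fintype.card V : ℝ) ^ (3 * m) * (5 * Real.exp (-(m * t / 10))) < 1 := by
    have hV : (0 : ℝ) < Fintype.card V := by exact_mod_cast Fintype.card_pos
    have hmt' : (100 : ℝ) ≤ m * t := by exact_mod_cast hmt
    have e1 : (Fintype.card V : ℝ) ^ (3 * m) ≤ Real.exp (3 * (m * t) / 100) := by
      rw [← Real.exp_log hV, ← Real.exp_nat_mul]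
      refine Real.exp_le_exp.2 ?_
      push_cast
      nlinarith [(Nat.cast_nonneg m : (0 : ℝ) ≤ m)]
    have e2 : (5 : ℝ) < Real.exp (7 * (m * t) / 100) := by
      linarith [Real.add_one_le_exp (7 * (m * t : ℝ) / 100)]
    calc _ ≤ Real.exp (3 * (m * t) / 100) * (5 * Real.exp (-(m * t / 10))) :=
          mul_le_mul_of_nonneg_right e1 (by positivity)
      _ < Real.exp (3 * (m * t) / 100) *
            (Real.exp (7 * (m * t) / 100) * Real.exp (-(m * t / 10))) := by gcongr
      _ = 1 := by
          rw [← Real.exp_add, ← Real.exp_add, Real.exp_eq_one_iff]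
          ring
  exact absurd (hone.trans hc) (not_le.2 hlt)

/-! ### The triple colouring: red subgraphs and blue cliques -/

variable {V K : Type*} [DecidableEq V]

/-- All pairs in `e` have colour `i` and are separated by the labelling `l i`. -/
def IsRainbowMono (l : K → V → Fin 3) (c : Sym2 V → K) (i : K) (e : Finset V) : Prop :=
  ∀ u ∈ e, ∀ v ∈ e, u ≠ v → c s(u, v) = i ∧ l i u ≠ l i v

/-- A triple is red if its pairs have the same colour and it is rainbow in the corresponding
labelling. -/
noncomputable def tripleColoring (l : K → V → Fin 3) (c : Sym2 V → K) :
    (ThreeGraph.complete V).EdgeColoring :=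
  fun e => if ∃ i, IsRainbowMono l c i e then RBColor.red else RBColor.blue

lemma IsRainbowMono.eq_of_two_le_card_inter {l : K → V → Fin 3} {c : Sym2 V → K} {i j : K}
    {e f : Finset V} (he : IsRainbowMono l c i e) (hf : IsRainbowMono l c j f)
    (h : 2 ≤ #(e ∩ f)) : i = j := by
  obtain ⟨u, hu, v, hv, huv⟩ := Finset.one_lt_card.1 h
  rw [mem_inter] at hu hv
  rw [← (he u hu.1 v hv.1 huv).1, (hf u hu.2 v hv.2 huv).1]

lemma tripartite_of_red (l : K → V → Fin 3) (c : Sym2 V → K) (H : ThreeGraph V)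
    (hred : ThreeGraph.IsRedSubgraph (tripleColoring l c) H) (hH : H.TightlyConnected) :
    H.Tripartite := by
  have hmono : ∀ e ∈ H.edges, ∃ i, IsRainbowMono l c i e := by
    intro e he
    have := hred.2 ⟨e, hred.1.2 he⟩ he
    by_contra hcon
    simp [tripleColoring, hcon] at this
  rcases H.edges.eq_empty_or_nonempty with h0 | ⟨e₀, he₀⟩
  · exact ⟨fun _ => 0, fun e he => by simp [h0] at he⟩
  obtain ⟨i, hi⟩ := hmono e₀ he₀
  -- The colour is passed on along a tight path, as consecutive edges share a pair.
  have hall : ∀ e ∈ H.edges, IsRainbowMono l c i e := by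
    suffices h : ∀ e : H.edges, IsRainbowMono l c i e from fun e he => h ⟨e, he⟩
    intro e
    have hpath := hH ⟨e₀, he₀⟩ e
    induction hpath with
    | refl => exact hi
    | @tail f g _ hfg ih =>
      obtain ⟨j, hj⟩ := hmono g g.2
      exact (ih.eq_of_two_le_card_inter hj hfg.ge) ▸ hj
  refine ⟨fun v => l i v, fun e he k => ?_⟩
  have hinj : Set.InjOn (l i) e := by
    intro u hu v hv huv
    by_contra hne
    exact (hall e he u hu v hv hne).2 huv
  have himg : e.image (l i) = univ := by
    refine Finset.eq_univ_of_card _ ?_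
    rw [Finset.card_image_of_injOn hinj, H.card_eq_three e he, Fintype.card_fin]
  obtain ⟨v, hv, hvk⟩ := Finset.mem_image.1 (himg ▸ mem_univ k)
  refine ⟨⟨v, H.edge_subset_verts e he v hv⟩, ⟨hv, hvk⟩, ?_⟩
  rintro ⟨w, hw⟩ ⟨hwe, hwk⟩
  exact Subtype.ext (hinj hwe hv (hwk.trans hvk.symm))

lemma card_lt_of_isBlueClique {l : K → V → Fin 3} {c : Sym2 V → K} {m : ℕ}
    (hlc : ∀ σ : Fin 3 × Fin m → V,
      Function.Injective σ → ∃ a b d i, Rainbow (l i) (σ (0, a)) (σ (1, b)) (σ (2, d)) ∧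
        c s(σ (0, a), σ (1, b)) = i ∧ c s(σ (0, a), σ (2, d)) = i ∧
        c s(σ (1, b), σ (2, d)) = i)
    {S : Finset V} (hS : ThreeGraph.IsBlueClique (tripleColoring l c) S) : #S < 3 * m := by
  by_contra! hcard
  obtain ⟨σ⟩ : Nonempty (Fin 3 × Fin m ↪ S) :=
    Function.Embedding.nonempty_of_card_le (by simpa using hcard)
  obtain ⟨a, b, d, i, ⟨r1, r2, r3⟩, c1, c2, c3⟩ := hlc (fun z => (σ z : V))
    (Subtype.val_injective.comp σ.injective)
  have hne : ∀ {u v : V}, l i u ≠ l i v → u ≠ v := fun h huv => h (by rw [huv])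
  obtain ⟨he, hblue⟩ := hS.2 {(σ (0, a) : V), (σ (1, b) : V), (σ (2, d) : V)} (by
    intro v hv
    simp only [mem_insert, mem_singleton] at hv
    rcases hv with rfl | rfl | rfl <;> exact Subtype.coe_prop _)
    (Finset.card_eq_three.2 ⟨_, _, _, hne r1, hne r2, hne r3, rfl⟩)
  have hred : ∃ i, IsRainbowMono l c i {(σ (0, a) : V), (σ (1, b) : V), (σ (2, d) : V)} := by
    refine ⟨i, ?_⟩
    intro u hu v hv huv
    simp only [mem_insert, mem_singleton] at hu hv
    rcases hu with rfl | rfl | rfl <;> rcases hv with rfl | rfl | rfl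
    · exact absurd rfl huv
    · exact ⟨c1, r1⟩
    · exact ⟨c2, r2⟩
    · exact ⟨by rw [Sym2.eq_swap]; exact c1, r1.symm⟩
    · exact absurd rfl huv
    · exact ⟨c3, r3⟩
    · exact ⟨by rw [Sym2.eq_swap]; exact c2, r2.symm⟩
    · exact ⟨by rw [Sym2.eq_swap]; exact c3, r3.symm⟩
    · exact absurd rfl huv
  simp [tripleColoring, hred] at hblue

end

end TightRamsey

/-! ### Choice of parameters -/

theorem theorem2p1 :
    ∃ C : ℝ, 0 < C ∧
      ∀ N : ℕ, 1 ≤ N →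
        ∃ χ : (ThreeGraph.complete (Fin N)).EdgeColoring,
          (∀ H : ThreeGraph (Fin N),
            ThreeGraph.IsRedSubgraph χ H → H.TightlyConnected → H.Tripartite) ∧
          (2 ≤ N → ∀ S : Finset (Fin N), ThreeGraph.IsBlueClique χ S →
            (S.card : ℝ) ≤ C * (Real.log (N : ℝ)) ^ (3 / 2 : ℝ)) := by
  set R : ℕ := ⌈24 * Real.exp 480⌉₊
  have hRle : 24 * Real.exp 480 ≤ R := Nat.le_ceil _
  have hR1 : 100 ≤ R := by
    have : (100 : ℝ) ≤ R := by linarith [Real.add_one_le_exp (480 : ℝ)]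
    exact_mod_cast this
  refine ⟨12 * (12 + 2 * R) ^ 3, by positivity, fun N hN => ?_⟩
  have : NeZero N := ⟨by omega⟩
  by_cases h2 : 2 ≤ N
  swap
  · exact ⟨TightRamsey.tripleColoring (fun (_ : Unit) _ => 0) (fun _ => ()),
      TightRamsey.tripartite_of_red _ _, fun h => absurd h h2⟩
  set s : ℝ := Real.sqrt (Real.log N)
  have hlog : 1 / 4 ≤ Real.log N := by
    have h3 : Real.log 2 ≤ Real.log N :=
      Real.log_le_log (by norm_num) (by exact_mod_cast h2)
    linarith [Real.log_two_gt_d9]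
  have hs2 : s ^ 2 = Real.log N := Real.sq_sqrt (by linarith)
  have hs0 : 1 / 2 ≤ s := Real.le_sqrt_of_sq_le (by linarith)
  -- The term `10 * s` makes `t = r ^ 2` at least `100 * log N`; `R` absorbs the constants with `exp
  -- 480`. With `m = 4 * r ^ 3`, `16 * t ^ 3 = m ^ 2` exactly.
  set r : ℕ := ⌈10 * s⌉₊ + R with hr
  have hr1 : 10 * s ≤ r := by
    have := Nat.le_ceil (10 * s)
    rw [hr]; push_cast
    linarith [(Nat.cast_nonneg R : (0 : ℝ) ≤ R)]
  have hr2 : (r : ℝ) ≤ (12 + 2 * R) * s := by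
    have := Nat.ceil_lt_add_one (show 0 ≤ 10 * s by linarith)
    rw [hr]; push_cast
    nlinarith [(Nat.cast_nonneg R : (0 : ℝ) ≤ R)]
  have hrR : (R : ℝ) ≤ r := by rw [hr]; push_cast; linarith [Nat.cast_nonneg (α := ℝ) ⌈10 * s⌉₊]
  have hr0 : (0 : ℝ) ≤ r := Nat.cast_nonneg r
  obtain ⟨l, c, hlc⟩ := TightRamsey.exists_pair_coloring (V := Fin N) (t := r ^ 2) (m := 4 * r ^ 3)
    (by
      rw [Fintype.card_fin, ← hs2]; push_cast
      nlinarith)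
    (by
      have h100 : 100 ≤ r := by omega
      have h3 : 1 ≤ r ^ 2 := Nat.one_le_pow _ _ (by omega)
      have h4 : r ≤ r ^ 3 := Nat.le_self_pow (by norm_num) r
      nlinarith)
    (by
      push_cast
      have h4 : 4 * Real.exp 480 ≤ r := by linarith [Real.exp_pos 480]
      calc 4 * (r : ℝ) ^ 3 * Real.exp 480 = (r : ℝ) ^ 3 * (4 * Real.exp 480) := by ring
        _ ≤ (r : ℝ) ^ 3 * r := mul_le_mul_of_nonneg_left h4 (by positivity)
        _ = _ := by ring)
    (by push_cast; exact le_of_eq (by ring))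
    (by
      push_cast
      calc 24 * Real.exp 480 * (r : ℝ) ^ 2 ≤ r * r ^ 2 :=
            mul_le_mul_of_nonneg_right (hRle.trans hrR) (by positivity)
        _ ≤ 4 * r ^ 3 := by nlinarith [pow_nonneg hr0 3])
  refine ⟨TightRamsey.tripleColoring l c, TightRamsey.tripartite_of_red l c, fun _ S hS => ?_⟩
  have hcard : (S.card : ℝ) ≤ 12 * (r : ℝ) ^ 3 := by
    have := (TightRamsey.card_lt_of_isBlueClique hlc hS).le
    calc (S.card : ℝ) ≤ ((3 * (4 * r ^ 3) : ℕ) : ℝ) := Nat.cast_le.2 this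
      _ = _ := by push_cast; ring
  have hpow : Real.log N ^ (3 / 2 : ℝ) = s ^ 3 := by
    rw [← hs2, ← Real.rpow_natCast s 2, ← Real.rpow_mul (by linarith), ← Real.rpow_natCast s 3]
    norm_num
  calc (S.card : ℝ) ≤ 12 * (r : ℝ) ^ 3 := hcard
    _ ≤ 12 * ((12 + 2 * R) * s) ^ 3 := by gcongr
    _ = _ := by rw [hpow]; ring
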